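/- Let $l\ge 1$, let $e_1,\dots,e_{l+1}$ be the standard basis of $\mathbb{R}^{l+1}$, let $\alpha_i=e_i-e_{i+1}$ ($1\le i\le l$) be the simple roots of type $A_l$, and let $m=(m_{i,j})_{1\le i<j\le l+1}$ be positive integers with $M=\sum_{i<j}m_{i,j}$. For $h=q_1\alpha_1+\cdots+q_l\alpha_l$ let $$P_{l,m}(h)=\Big\{(x_{i,j}^k)_{1\le i<j\le l+1,\ 1\le k\le m_{i,j}}\in\mathbb{R}^M \ \Big|\ x_{i,j}^k\ge 0,\ \sum_{i<j}\sum_{k}x_{i,j}^k(e_i-e_j)=h\Big\}$$ be the flow polytope and let $v_{l,m}(h)$ be its $(M-l)$-dimensional volume, taken in the affine subspace $\{x\in\mathbb{R}^M : \sum_{i<j}\sum_k x_{i,j}^k(e_i-e_j)=h\}$ with respect to Lebesgue measure normalized so that the lattice $\{x\in\mathbb{Z}^M : \sum_{i<j}\sum_k x_{i,j}^k(e_i-e_j)=0\}$ has covolume $1$. Regard $v_{l,m}$ as a function of $q=(q_1,\dots,q_l)$, write $\partial_i=\partial/\partial q_i$, and let $$\mathfrak{c}_{\mathrm{nice}}=\{q_1\alpha_1+\cdots+q_l\alpha_l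 \mid 0<q_1<q_2<\cdots<q_l\}$$ be the nice chamber. Then $v_{l,m}$ agrees on $\mathfrak{c}_{\mathrm{nice}}$ with a polynomial in $q_1,\dots,q_l$, and the annihilator $$\mathrm{Ann}(v_{l,m})=\{P\in\mathbb{R}[\partial_1,\dots,\partial_l] \mid P\,v_{l,m}=0 \text{ on } \mathfrak{c}_{\mathrm{nice}}\}$$ is the ideal of $\mathbb{R}[\partial_1,\dots,\partial_l]$ generated by the $l$ operators $$\partial_i^{m_{i,i+1}}(\partial_i+\partial_{i+1})^{m_{i,i+2}}\cdots(\partial_i+\cdots+\partial_l)^{m_{i,l+1}},\qquad i=1,\dots,l.$$ -/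

import Mathlib

open MvPolynomial

noncomputable section

/-- The pairs `i < j` of vertices `1, …, l+1` (numbered from `0` here), which index the positive
roots `e_i - e_j` of type `A_l`. -/
abbrev PosPair (l : ℕ) : Type := {p : Fin (l + 1) × Fin (l + 1) // p.1 < p.2}

/-- The positive root `e_i - e_j` in `ℝ^{l+1}`. -/
def posRoot {l : ℕ} (p : PosPair l) : Fin (l + 1) → ℝ :=
  Pi.single p.1.1 1 - Pi.single p.1.2 1

/-- The simple root `α_i = e_i - e_{i+1}`. -/
def simpleRoot {l : ℕ} (i : Fin l) : Fin (l + 1) → ℝ :=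
  Pi.single i.castSucc 1 - Pi.single i.succ 1

/-- The vector `h = q_1 α_1 + ⋯ + q_l α_l`. -/
def rootComb {l : ℕ} (q : Fin l → ℝ) : Fin (l + 1) → ℝ :=
  ∑ i, q i • simpleRoot i

/-- The index set of the coordinates `x_{i,j}^k`, `i < j`, `1 ≤ k ≤ m_{i,j}`; it has
`M = ∑_{i<j} m_{i,j}` elements. -/
abbrev FlowIndex (l : ℕ) (m : Fin (l + 1) → Fin (l + 1) → ℕ) : Type :=
  Σ p : PosPair l, Fin (m p.1.1 p.1.2)

/-- The flow polytope `P_{l,m}(h) ⊆ ℝ^M`. -/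
def flowPolytope (l : ℕ) (m : Fin (l + 1) → Fin (l + 1) → ℕ) (h : Fin (l + 1) → ℝ) :
    Set (FlowIndex l m → ℝ) :=
  {x | (∀ a, 0 ≤ x a) ∧ ∑ a, x a • posRoot a.1 = h}

/-- All coordinates other than the `l` coordinates `x_{i,i+1}^1`, `1 ≤ i ≤ l`. -/
abbrev FreeIndex (l : ℕ) (m : Fin (l + 1) → Fin (l + 1) → ℕ) : Type :=
  {a : FlowIndex l m // ¬ ((a.1.1.1 : ℕ) + 1 = (a.1.1.2 : ℕ) ∧ (a.2 : ℕ) = 0)}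

/-- The volume `v_{l,m}(h)` of the flow polytope, `h = ∑ q_i α_i`, as a function of `q`.

`P_{l,m}(h)` lies in the affine subspace of `ℝ^M` given by
`∑_{a ≤ i < b} ∑_k x_{a,b}^k = q_i` for `i = 1, …, l`, of dimension `M - l`; its volume is taken
with respect to the Lebesgue measure of that subspace normalized by the lattice of integer points.
The `i`-th equation expresses `x_{i,i+1}^1` as `q_i` minus a sum of coordinates of which
none is `x_{j,j+1}^1` for any `j`. Hence, as all `m_{i,j}` are positive, forgetting the coordinates
`x_{i,i+1}^1` maps the affine subspace bijectively onto `ℝ^{M-l}`, and (for integral `q`) its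
integer points bijectively onto `ℤ^{M-l}`: the normalized volume is the Lebesgue measure of the
image. -/
def flowVolume (l : ℕ) (m : Fin (l + 1) → Fin (l + 1) → ℕ) (q : Fin l → ℝ) : ℝ :=
  MeasureTheory.volume.real
    ((fun (x : FlowIndex l m → ℝ) (a : FreeIndex l m) => x a.1) ''
      flowPolytope l m (rootComb q))

/-- The nice chamber `0 < q_1 < q_2 < ⋯ < q_l`, in the coordinates `q` of `h = ∑ q_i α_i`. -/
def niceChamber (l : ℕ) : Set (Fin l → ℝ) :=
  {q | (∀ i, 0 < q i) ∧ StrictMono q}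

/-- The partial derivative `∂_i f = ∂f / ∂q_i`. -/
def partialDeriv {l : ℕ} (i : Fin l) (f : (Fin l → ℝ) → ℝ) : (Fin l → ℝ) → ℝ :=
  fun q => lineDeriv ℝ f q (Pi.single i 1)

/-- The iterated partial derivative `∂_1^{s_1} ⋯ ∂_l^{s_l} f`. -/
def multiDeriv {l : ℕ} (s : Fin l →₀ ℕ) (f : (Fin l → ℝ) → ℝ) : (Fin l → ℝ) → ℝ :=
  (List.finRange l).foldr (fun i g => (partialDeriv i)^[s i] g) f

/-- The function `P(∂_1, …, ∂_l) f`. The ring `ℝ[∂_1, …, ∂_l]` of differential operators with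
constant coefficients is `MvPolynomial (Fin l) ℝ`, with the variable `X i` standing for `∂_i`. -/
def diffOp {l : ℕ} (P : MvPolynomial (Fin l) ℝ) (f : (Fin l → ℝ) → ℝ) : (Fin l → ℝ) → ℝ :=
  fun q => ∑ s ∈ P.support, P.coeff s * multiDeriv s f q

/-- `Ann(f)` for a function `f` on the open set `U`: the constant-coefficient differential
operators `P` with `P f = 0` on `U`. -/
def annihilator {l : ℕ} (U : Set (Fin l → ℝ)) (f : (Fin l → ℝ) → ℝ) :
    Set (MvPolynomial (Fin l) ℝ) :=
  {P | ∀ q ∈ U, diffOp P f q = 0}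

/-- The operator `∂_i^{m_{i,i+1}} (∂_i + ∂_{i+1})^{m_{i,i+2}} ⋯ (∂_i + ⋯ + ∂_l)^{m_{i,l+1}}`:
the factor belonging to `j > i` is `(∂_i + ⋯ + ∂_{j-1})^{m_{i,j}}`. -/
def flowOperator (l : ℕ) (m : Fin (l + 1) → Fin (l + 1) → ℕ) (i : Fin l) :
    MvPolynomial (Fin l) ℝ :=
  ∏ j ∈ Finset.Ioi i.castSucc,
    (∑ k : Fin l with i ≤ k ∧ k.castSucc < j, X k) ^ m i.castSucc j

end

noncomputable section

/-! ### Constant-coefficient differential operators on polynomials -/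

/-! The coordinates `x_{i,i+1}^1` are slack variables. Without them the flow polytope becomes `{y ≥
0, ∑ y_a χ_a ≤ q}`, where `χ_a` is the indicator of the interval of simple roots in the root of the
edge `a` (`image_flowPolytope`). By Fubini its volume is built from `1` by adding edges in
decreasing order of source. Adding `a` with source `i` replaces `V` by `W(q) = ∫_0^{q_i} V(q - y
χ_a) dy`. As `χ_a` decreases from its source on, the slices stay where `q ≥ 0` and `q_i ≤ q_{i+1} ≤
⋯`, so a single polynomial formula remains valid (`volume_edgePolytope_list`).

Algebraically, `W` is the unique polynomial with `χ_a(∂) W = V` and `W = 0` on `q_i = 0`. The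
annihilator of `1` is generated by the `∂_k`, and adding `a` multiplies the `i`-th generator `D_i`
by `χ_a(∂)`; the other generators do not involve `∂_i`, so they still kill `W`. Conversely, if `P W
= 0`, write `P = c + χ_a Q` with `c` free of `∂_i`. Applying `D_i` gives `c D_i W = 0`. Since `D_i
W` on `q_i = 0` is the first nonzero normal derivative of `W`, this forces `c` into the ideal of the
other generators (`VanishesToOrder`). Hence `c W = 0`, so `Q V = 0`, and induction applies to `Q`
(`polyAnn_edgeIntegral`, `polyAnn_flowPoly_aux`). -/

theorem pderiv_commute {l : ℕ} (i j : Fin l) (f : MvPolynomial (Fin l) ℝ) :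
    pderiv i (pderiv j f) = pderiv j (pderiv i f) := by
  have h : ⁅(pderiv i : Derivation ℝ (MvPolynomial (Fin l) ℝ) (MvPolynomial (Fin l) ℝ)),
      (pderiv j : Derivation ℝ (MvPolynomial (Fin l) ℝ) (MvPolynomial (Fin l) ℝ))⁆ = 0 := by
    -- A commutator of derivations is a derivation, so it is enough to check the variables.
    refine MvPolynomial.derivation_ext fun k => ?_
    rw [Derivation.commutator_apply]
    classical
    simp [pderiv_X, Pi.single_apply, apply_ite]
  have := congrArg (fun D => D f) h
  simpa [Derivation.commutator_apply, sub_eq_zero] using this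

/-- The partial derivatives as endomorphisms. -/
def pderivSet (l : ℕ) : Set (Module.End ℝ (MvPolynomial (Fin l) ℝ)) :=
  Set.range fun i => (pderiv i : Derivation ℝ _ _).toLinearMap

theorem pderivSet_commute (l : ℕ) :
    ∀ a ∈ pderivSet l, ∀ b ∈ pderivSet l, a * b = b * a := by
  rintro _ ⟨i, rfl⟩ _ ⟨j, rfl⟩
  ext1 f
  simpa using LinearMap.ext fun c => pderiv_commute i j _

open scoped IsMulCommutative in
/-- The action of `P(∂)` on polynomials. -/
def polyDiffOp (l : ℕ) :
    MvPolynomial (Fin l) ℝ →ₐ[ℝ] Module.End ℝ (MvPolynomial (Fin l) ℝ) :=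
  -- `aeval` needs a commutative target, which the full endomorphism ring is not; the subalgebra
  -- generated by the commuting `pderiv i` is.
  haveI := Algebra.isMulCommutative_adjoin ℝ (pderivSet_commute l)
  (Algebra.adjoin ℝ (pderivSet l)).val.comp
    (aeval fun i => (⟨_, Algebra.subset_adjoin ⟨i, rfl⟩⟩ : Algebra.adjoin ℝ (pderivSet l)))

open scoped IsMulCommutative in
@[simp]
theorem polyDiffOp_X {l : ℕ} (i : Fin l) (f : MvPolynomial (Fin l) ℝ) :
    polyDiffOp l (X i) f = pderiv i f := by
  have := Algebra.isMulCommutative_adjoin ℝ (pderivSet_commute l)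
  simp only [polyDiffOp, AlgHom.comp_apply]
  rw [aeval_X]
  rfl

theorem polyDiffOp_C {l : ℕ} (c : ℝ) (f : MvPolynomial (Fin l) ℝ) :
    polyDiffOp l (C c) f = c • f := by
  have : (C c : MvPolynomial (Fin l) ℝ) = algebraMap ℝ _ c := rfl
  rw [this, AlgHom.commutes]
  rfl

theorem polyDiffOp_mul {l : ℕ} (P Q f : MvPolynomial (Fin l) ℝ) :
    polyDiffOp l (P * Q) f = polyDiffOp l P (polyDiffOp l Q f) := by
  rw [map_mul]; rfl

theorem polyDiffOp_comm {l : ℕ} (P Q f : MvPolynomial (Fin l) ℝ) :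
    polyDiffOp l P (polyDiffOp l Q f) = polyDiffOp l Q (polyDiffOp l P f) := by
  rw [← polyDiffOp_mul, mul_comm, polyDiffOp_mul]

theorem polyDiffOp_add {l : ℕ} (P Q f : MvPolynomial (Fin l) ℝ) :
    polyDiffOp l (P + Q) f = polyDiffOp l P f + polyDiffOp l Q f := by
  rw [map_add]; rfl

/-- The annihilator of a polynomial in the ring of constant-coefficient operators. -/
def polyAnn {l : ℕ} (V : MvPolynomial (Fin l) ℝ) : Ideal (MvPolynomial (Fin l) ℝ) where
  carrier := {P | polyDiffOp l P V = 0}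
  add_mem' {P Q} hP hQ := by
    simp only [Set.mem_ofPred_eq] at *
    rw [polyDiffOp_add, hP, hQ, add_zero]
  zero_mem' := by simp
  smul_mem' P Q hQ := by
    simp only [Set.mem_ofPred_eq, smul_eq_mul] at *
    rw [polyDiffOp_mul, hQ, map_zero]

theorem mem_polyAnn {l : ℕ} {V P : MvPolynomial (Fin l) ℝ} :
    P ∈ polyAnn V ↔ polyDiffOp l P V = 0 := Iff.rfl

/-! ### Restriction to a coordinate hyperplane -/

/-- The substitution `X i := 0`. -/
def restrictZero {l : ℕ} (i : Fin l) : MvPolynomial (Fin l) ℝ →ₐ[ℝ] MvPolynomial (Fin l) ℝ :=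
  aeval (Function.update X i 0)

/-- The polynomials in the variables other than `X i`. -/
abbrev freeOf {l : ℕ} (i : Fin l) : Subalgebra ℝ (MvPolynomial (Fin l) ℝ) :=
  supported ℝ ({i}ᶜ : Set (Fin l))

theorem restrictZero_X_self {l : ℕ} (i : Fin l) : restrictZero i (X i) = 0 := by
  simp [restrictZero]

theorem restrictZero_X_of_ne {l : ℕ} {i k : Fin l} (h : k ≠ i) :
    restrictZero i (X k) = X k := by
  simp [restrictZero, h]

theorem restrictZero_of_free {l : ℕ} {i : Fin l} {c : MvPolynomial (Fin l) ℝ}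
    (hc : c ∈ freeOf i) : restrictZero i c = c := by
  refine Algebra.adjoin_induction (p := fun c _ => restrictZero i c = c) ?_ ?_ ?_ ?_ hc
  · rintro _ ⟨k, hk, rfl⟩
    exact restrictZero_X_of_ne hk
  · intro r; exact AlgHom.commutes _ r
  · intro x y _ _ hx hy; rw [map_add, hx, hy]
  · intro x y _ _ hx hy; rw [map_mul, hx, hy]

theorem restrictZero_pderiv {l : ℕ} {i k : Fin l} (h : k ≠ i) (f : MvPolynomial (Fin l) ℝ) :
    restrictZero i (pderiv k f) = pderiv k (restrictZero i f) := by
  induction f using MvPolynomial.induction_on with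
  | C a => simp [restrictZero]
  | add p q hp hq => simp only [map_add, hp, hq]
  | mul_X p j hp =>
    by_cases hj : j = i
    · subst hj
      simp [restrictZero_X_self, pderiv_X_of_ne h.symm]
    · simp only [pderiv_mul, map_mul, map_add, restrictZero_X_of_ne hj, hp, pderiv_X]
      by_cases hjk : k = j
      · subst hjk; simp
      · simp [Ne.symm hjk]

/-- Differentiation along the hyperplane `q_i = 0` can be done before or after restricting to it. -/
theorem restrictZero_polyDiffOp {l : ℕ} {i : Fin l} {c : MvPolynomial (Fin l) ℝ}
    (hc : c ∈ freeOf i) (f : MvPolynomial (Fin l) ℝ) :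
    restrictZero i (polyDiffOp l c f) = polyDiffOp l c (restrictZero i f) := by
  refine Algebra.adjoin_induction (p := fun c _ => ∀ f, restrictZero i (polyDiffOp l c f) =
    polyDiffOp l c (restrictZero i f)) ?_ ?_ ?_ ?_ hc f
  · rintro _ ⟨k, hk, rfl⟩ f
    simpa using restrictZero_pderiv hk f
  · intro r f
    have : algebraMap ℝ (MvPolynomial (Fin l) ℝ) r = C r := rfl
    rw [this, polyDiffOp_C, polyDiffOp_C, map_smul]
  · intro x y _ _ hx hy f; rw [polyDiffOp_add, polyDiffOp_add, map_add, hx, hy]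
  · intro x y _ _ hx hy f; simp only [polyDiffOp_mul, hx, hy]

theorem eval_restrictZero {l : ℕ} (i : Fin l) (q : Fin l → ℝ) (f : MvPolynomial (Fin l) ℝ) :
    eval q (restrictZero i f) = eval (Function.update q i 0) f := by
  induction f using MvPolynomial.induction_on with
  | C a => simp [restrictZero]
  | add p q hp hq => simp only [map_add, hp, hq]
  | mul_X p j hp =>
    simp only [map_mul, hp]
    by_cases hj : j = i
    · subst hj; simp [restrictZero_X_self]
    · simp [restrictZero_X_of_ne hj, hj]

/-! ### Directional derivatives -/

/-- The linear form `∑ χ_k X_k`, that is, the directional derivative along `χ`. -/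
def linForm {l : ℕ} (χ : Fin l → ℝ) : MvPolynomial (Fin l) ℝ :=
  ∑ k, C (χ k) * X k

theorem polyDiffOp_linForm {l : ℕ} (χ : Fin l → ℝ) (f : MvPolynomial (Fin l) ℝ) :
    polyDiffOp l (linForm χ) f = ∑ k, χ k • pderiv k f := by
  rw [linForm, map_sum, LinearMap.sum_apply]
  exact Finset.sum_congr rfl fun k _ => by rw [polyDiffOp_mul, polyDiffOp_C, polyDiffOp_X]

theorem linForm_single {l : ℕ} (i : Fin l) : linForm (Pi.single i 1) = X i := by
  simp [linForm, Pi.single_apply, Finset.sum_ite_eq', apply_ite, ite_mul]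

theorem linForm_sub_mem_freeOf {l : ℕ} {χ : Fin l → ℝ} {i : Fin l} (h : χ i = 1) :
    linForm χ - X i ∈ freeOf i := by
  have : linForm χ - X i = ∑ k ∈ Finset.univ.erase i, C (χ k) * X k := by
    rw [linForm, ← Finset.add_sum_erase _ _ (Finset.mem_univ i), h]
    simp
  rw [this]
  refine Subalgebra.sum_mem _ fun k hk => Subalgebra.mul_mem _ (Subalgebra.algebraMap_mem _ _) ?_
  exact Algebra.subset_adjoin ⟨k, by simpa using hk, rfl⟩

theorem linForm_mem_freeOf {l : ℕ} {χ : Fin l → ℝ} {i : Fin l} (h : χ i = 0) :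
    linForm χ ∈ freeOf i := by
  rw [linForm, ← Finset.add_sum_erase _ _ (Finset.mem_univ i), h]
  simp only [map_zero, zero_mul, zero_add]
  refine Subalgebra.sum_mem _ fun k hk => Subalgebra.mul_mem _ (Subalgebra.algebraMap_mem _ _) ?_
  exact Algebra.subset_adjoin ⟨k, by simpa using hk, rfl⟩

theorem hasDerivAt_eval_line {l : ℕ} (f : MvPolynomial (Fin l) ℝ) (q χ : Fin l → ℝ) (t : ℝ) :
    HasDerivAt (fun t : ℝ => eval (q + t • χ) f)
      (eval (q + t • χ) (polyDiffOp l (linForm χ) f)) t := by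
  simp only [polyDiffOp_linForm]
  induction f using MvPolynomial.induction_on with
  | C a => simpa using hasDerivAt_const t a
  | add p r hp hr =>
    simp only [map_add, smul_add, Finset.sum_add_distrib]
    simp only [← map_add]
    simpa only [map_add] using hp.fun_add hr
  | mul_X p j hp =>
    have h1 : HasDerivAt (fun t : ℝ => q j + t * χ j) (χ j) t := by
      simpa using ((hasDerivAt_id t).mul_const (χ j)).const_add (q j)
    have h2 := hp.fun_mul h1
    simp only [map_mul, eval_X, Pi.add_apply, Pi.smul_apply, smul_eq_mul]
    refine h2.congr_deriv ?_
    symm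
    simp only [pderiv_mul, smul_add, Finset.sum_add_distrib, map_add, map_sum, smul_eval, map_mul,
      eval_X, pderiv_X, Pi.add_apply, Pi.smul_apply, smul_eq_mul, Finset.sum_mul]
    congr 1
    · exact Finset.sum_congr rfl fun _ _ => by ring
    · rw [Finset.sum_eq_single j]
      · simp; ring
      · intro k _ hk; simp [Ne.symm hk]
      · simp

/-- Solution of `χ(∂) u = f` with `u = 0` on `q_i = 0`, by integration along `χ`. -/
theorem eval_eq_integral {l : ℕ} {χ : Fin l → ℝ} {i : Fin l} (h : χ i = 1)
    {u f : MvPolynomial (Fin l) ℝ} (hu : polyDiffOp l (linForm χ) u = f)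
    (h0 : restrictZero i u = 0) (q : Fin l → ℝ) :
    eval q u = ∫ y in (0 : ℝ)..q i, eval (q - y • χ) f := by
  have hd : ∀ y ∈ Set.uIcc 0 (q i), HasDerivAt (fun y : ℝ => - eval (q - y • χ) u)
      (eval (q - y • χ) f) y := by
    intro y _
    have := hasDerivAt_eval_line u q χ (-y)
    have h2 := (this.comp y (hasDerivAt_neg y)).fun_neg
    simp only [Function.comp_def, neg_smul, ← sub_eq_add_neg, hu] at h2
    simpa using h2
  have hc : Continuous fun y : ℝ => eval (q - y • χ) f :=
    (MvPolynomial.continuous_eval f).comp (by fun_prop)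
  rw [intervalIntegral.integral_eq_sub_of_hasDerivAt hd (hc.intervalIntegrable _ _)]
  -- Because `χ i = 1`, the line through `q` along `χ` meets the hyperplane at parameter `q i`.
  have hz : eval (q - q i • χ) u = 0 := by
    have h1 := eval_restrictZero i (q - q i • χ) u
    rw [h0, map_zero] at h1
    rw [h1]
    congr 2
    refine (Function.update_eq_self_iff.2 ?_).symm
    simp [h]
  simp [hz]

theorem eq_zero_of_linForm_of_restrictZero {l : ℕ} {χ : Fin l → ℝ} {i : Fin l} (h : χ i = 1)
    {u : MvPolynomial (Fin l) ℝ} (hu : polyDiffOp l (linForm χ) u = 0)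
    (h0 : restrictZero i u = 0) : u = 0 := by
  refine MvPolynomial.funext fun q => ?_
  rw [eval_eq_integral h hu h0]
  simp

theorem exists_pderiv_eq {l : ℕ} (i : Fin l) (f : MvPolynomial (Fin l) ℝ) :
    ∃ u, pderiv i u = f ∧ X i ∣ u := by
  induction f using MvPolynomial.monomial_add_induction_on with
  | C a => exact ⟨C a * X i, by simp, Dvd.intro_left _ rfl⟩
  | monomial_add s a p _ _ hp =>
    obtain ⟨u, hu, hd⟩ := hp
    refine ⟨monomial (s + Finsupp.single i 1) (a / (s i + 1)) + u, ?_, dvd_add ?_ hd⟩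
    · rw [map_add, hu, pderiv_monomial]
      congr 2
      · simp
      · have : (s i : ℝ) + 1 ≠ 0 := by positivity
        simp [this]
    · rw [monomial_add_single, pow_one]
      exact Dvd.intro_left _ rfl

/-- The substitution `X k := X k + χ_k X i` for `k ≠ i`. -/
def shear {l : ℕ} (i : Fin l) (χ : Fin l → ℝ) :
    MvPolynomial (Fin l) ℝ →ₐ[ℝ] MvPolynomial (Fin l) ℝ :=
  aeval fun k => if k = i then X i else X k + C (χ k) * X i

theorem shear_X_self {l : ℕ} (i : Fin l) (χ : Fin l → ℝ) : shear i χ (X i) = X i := by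
  simp [shear]

theorem shear_X_of_ne {l : ℕ} {i k : Fin l} (h : k ≠ i) (χ : Fin l → ℝ) :
    shear i χ (X k) = X k + C (χ k) * X i := by
  simp [shear, h]

theorem shear_neg_shear {l : ℕ} (i : Fin l) (χ : Fin l → ℝ) (f : MvPolynomial (Fin l) ℝ) :
    shear i (-χ) (shear i χ f) = f := by
  have : (shear i (-χ)).comp (shear i χ) = AlgHom.id ℝ _ := by
    refine MvPolynomial.algHom_ext fun k => ?_
    by_cases hk : k = i
    · subst hk; simp [shear_X_self]
    · have hC : shear i (-χ) (C (χ k)) = C (χ k) := AlgHom.commutes (shear i (-χ)) (χ k)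
      simp [shear_X_of_ne hk, shear_X_self, hC]
  exact congrArg (fun φ => φ f) this

/-- Chain rule: the shear straightens `χ(∂)` to `∂_i`. It also fixes `X i`, so solving `χ(∂) u = f`
with zero data on `q_i = 0` reduces to finding an antiderivative in `q_i` divisible by `X i`. -/
theorem pderiv_shear {l : ℕ} {i : Fin l} {χ : Fin l → ℝ} (h : χ i = 1)
    (f : MvPolynomial (Fin l) ℝ) :
    pderiv i (shear i χ f) = shear i χ (polyDiffOp l (linForm χ) f) := by
  simp only [polyDiffOp_linForm]
  induction f using MvPolynomial.induction_on with
  | C a => simp [shear]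
  | add p q hp hq =>
    simp only [map_add, hp, hq, smul_add, Finset.sum_add_distrib]
  | mul_X p j hp =>
    have hX : pderiv i (shear i χ (X j)) = C (χ j) := by
      by_cases hj : j = i
      · subst hj; simp [shear_X_self, h]
      · simp [shear_X_of_ne hj, pderiv_X_of_ne hj]
    have hS : ∑ k, χ k • pderiv k (X j : MvPolynomial (Fin l) ℝ) = C (χ j) := by
      rw [Finset.sum_eq_single j]
      · simp [smul_eq_C_mul]
      · intro k _ hk; simp [pderiv_X, Ne.symm hk]
      · simp
    have hC : shear i χ (C (χ j)) = C (χ j) := AlgHom.commutes (shear i χ) (χ j)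
    have hS' : ∑ k, χ k • pderiv k (p * X j) =
        (∑ k, χ k • pderiv k p) * X j + p * C (χ j) := by
      rw [← hS, Finset.sum_mul, Finset.mul_sum, ← Finset.sum_add_distrib]
      refine Finset.sum_congr rfl fun k _ => ?_
      rw [pderiv_mul, smul_add, smul_mul_assoc, mul_smul_comm]
    rw [hS', map_mul, pderiv_mul, hp, hX, map_add, map_mul, map_mul, hC]

theorem exists_edgeIntegral {l : ℕ} {i : Fin l} {χ : Fin l → ℝ} (h : χ i = 1)
    (f : MvPolynomial (Fin l) ℝ) :
    ∃ u, polyDiffOp l (linForm χ) u = f ∧ restrictZero i u = 0 := by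
  obtain ⟨w, hw, v, rfl⟩ := exists_pderiv_eq i (shear i χ f)
  refine ⟨shear i (-χ) (X i * v), ?_, ?_⟩
  · have h1 := pderiv_shear h (shear i (-χ) (X i * v))
    have h2 := shear_neg_shear i (-χ) (X i * v)
    rw [neg_neg] at h2
    rw [h2, hw] at h1
    have h3 := congrArg (shear i (-χ)) h1
    rwa [shear_neg_shear, shear_neg_shear, eq_comm] at h3
  · rw [map_mul, shear_X_self, map_mul, restrictZero_X_self, zero_mul]

/-- The polynomial `u` with `χ(∂) u = f` and `u = 0` on `q_i = 0` (for `χ_i = 1`). -/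
def edgeIntegral {l : ℕ} (i : Fin l) (χ : Fin l → ℝ) (f : MvPolynomial (Fin l) ℝ) :
    MvPolynomial (Fin l) ℝ :=
  Classical.epsilon fun u => polyDiffOp l (linForm χ) u = f ∧ restrictZero i u = 0

theorem edgeIntegral_spec {l : ℕ} {i : Fin l} {χ : Fin l → ℝ} (h : χ i = 1)
    (f : MvPolynomial (Fin l) ℝ) :
    polyDiffOp l (linForm χ) (edgeIntegral i χ f) = f ∧ restrictZero i (edgeIntegral i χ f) = 0 :=
  Classical.epsilon_spec (exists_edgeIntegral h f)

/-! ### Annihilators and integration along an edge -/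

/-- Division with remainder by `linForm χ`, which is monic of degree one in `X i`. -/
theorem exists_free_add_linForm_mul {l : ℕ} {χ : Fin l → ℝ} {i : Fin l} (h : χ i = 1)
    (P : MvPolynomial (Fin l) ℝ) : ∃ c ∈ freeOf i, ∃ Q, P = c + linForm χ * Q := by
  induction P using MvPolynomial.induction_on with
  | C a => exact ⟨C a, Subalgebra.algebraMap_mem _ _, 0, by simp⟩
  | add p q hp hq =>
    obtain ⟨c, hc, Q, rfl⟩ := hp
    obtain ⟨d, hd, R, rfl⟩ := hq
    exact ⟨c + d, Subalgebra.add_mem _ hc hd, Q + R, by ring⟩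
  | mul_X p j hp =>
    obtain ⟨c, hc, Q, rfl⟩ := hp
    by_cases hj : j = i
    · subst hj
      refine ⟨-(c * (linForm χ - X j)), Subalgebra.neg_mem _
        (Subalgebra.mul_mem _ hc (linForm_sub_mem_freeOf h)), Q * X j + c, by ring⟩
    · exact ⟨c * X j, Subalgebra.mul_mem _ hc (Algebra.subset_adjoin ⟨j, hj, rfl⟩),
        Q * X j, by ring⟩

theorem restrictZero_mem_span {l : ℕ} {i : Fin l} {S : Set (MvPolynomial (Fin l) ℝ)}
    (hS : ∀ d ∈ S, d ∈ freeOf i) {P : MvPolynomial (Fin l) ℝ} (hP : P ∈ Ideal.span S) :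
    restrictZero i P ∈ Ideal.span S := by
  have : Ideal.span S ≤ (Ideal.span S).comap (restrictZero i) := by
    rw [Ideal.span_le]
    intro d hd
    change restrictZero i d ∈ Ideal.span S
    rw [restrictZero_of_free (hS d hd)]
    exact Ideal.subset_span hd
  exact this hP

/-- `V` vanishes to order `n` along `q_i = 0`, and its `n`-th derivative there is annihilated only
by `J`, among the operators which do not involve `∂_i`. -/
structure VanishesToOrder {l : ℕ} (i : Fin l) (V : MvPolynomial (Fin l) ℝ) (n : ℕ)
    (J : Ideal (MvPolynomial (Fin l) ℝ)) : Prop where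
  restrict_eq_zero : ∀ T : List (MvPolynomial (Fin l) ℝ), (∀ ψ ∈ T, ψ - X i ∈ freeOf i) →
    T.length < n → restrictZero i (polyDiffOp l T.prod V) = 0
  mem_of_restrict : ∀ T : List (MvPolynomial (Fin l) ℝ), (∀ ψ ∈ T, ψ - X i ∈ freeOf i) →
    T.length = n → ∀ c ∈ freeOf i, restrictZero i (polyDiffOp l (c * T.prod) V) = 0 → c ∈ J

/-- Here `∂_i V = 0`, so `V` does not depend on `q_i` and restriction to the hyperplane loses
nothing. -/
theorem vanishesToOrder_zero {l : ℕ} {i : Fin l} {V : MvPolynomial (Fin l) ℝ}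
    {S : Set (MvPolynomial (Fin l) ℝ)} (hS : ∀ d ∈ S, d ∈ freeOf i)
    (hV : polyAnn V = Ideal.span S ⊔ Ideal.span {X i}) :
    VanishesToOrder i V 0 (Ideal.span S) := by
  refine ⟨fun T _ h => absurd h (Nat.not_lt_zero _), fun T _ hT c hc h0 => ?_⟩
  obtain rfl := List.length_eq_zero_iff.1 hT
  rw [List.prod_nil, mul_one] at h0
  have hX : polyDiffOp l (X i) V = 0 := by
    rw [← mem_polyAnn, hV]
    exact Ideal.mem_sup_right (Ideal.subset_span rfl)
  have h1 : polyDiffOp l c V = 0 := by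
    refine eq_zero_of_linForm_of_restrictZero (χ := Pi.single i 1) (i := i) (by simp) ?_ h0
    rw [linForm_single, polyDiffOp_comm, hX, map_zero]
  rw [← mem_polyAnn, hV, Submodule.mem_sup] at h1
  obtain ⟨a, ha, b, hb, rfl⟩ := h1
  obtain ⟨b, rfl⟩ := Ideal.mem_span_singleton.1 hb
  have := restrictZero_mem_span hS ha
  rw [← restrictZero_of_free hc, map_add, map_mul, restrictZero_X_self, zero_mul, add_zero]
  exact this

/-- Every `ψ` congruent to `∂_i` modulo operators free of `∂_i` differs from `χ(∂)` by a tangential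
operator. On the hyperplane that difference acts on lower normal derivatives, which vanish, so one
factor `ψ` turns the integral back into `V`. -/
theorem VanishesToOrder.edgeIntegral {l : ℕ} {i : Fin l} {χ : Fin l → ℝ} (h : χ i = 1)
    {V : MvPolynomial (Fin l) ℝ} {n : ℕ} {J : Ideal (MvPolynomial (Fin l) ℝ)}
    (hV : VanishesToOrder i V n J) :
    VanishesToOrder i (edgeIntegral i χ V) (n + 1) J := by
  obtain ⟨h1, h2⟩ := edgeIntegral_spec h V
  set W := _root_.edgeIntegral i χ V
  -- Trade `ψ` for `χ(∂)`, which maps `W` to `V`; the error `ψ - χ` is free of `∂_i`.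
  have key : ∀ ψ : MvPolynomial (Fin l) ℝ, ∀ R, polyDiffOp l (ψ * R) W =
      polyDiffOp l R V + polyDiffOp l (ψ - X i - (linForm χ - X i)) (polyDiffOp l R W) := by
    intro ψ R
    have : ψ * R = R * linForm χ + (ψ - X i - (linForm χ - X i)) * R := by ring
    rw [this, polyDiffOp_add, polyDiffOp_mul, h1, polyDiffOp_mul]
  have hz : ∀ T : List (MvPolynomial (Fin l) ℝ), (∀ ψ ∈ T, ψ - X i ∈ freeOf i) →
      T.length < n + 1 → restrictZero i (polyDiffOp l T.prod W) = 0 := by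
    intro T hT hlen
    induction T with
    | nil => simpa using h2
    | cons ψ T ih =>
      rw [List.length_cons] at hlen
      have hT' : ∀ ψ ∈ T, ψ - X i ∈ freeOf i := fun φ hφ => hT φ (List.mem_cons_of_mem _ hφ)
      rw [List.prod_cons, key, map_add, hV.restrict_eq_zero T hT' (by omega),
        restrictZero_polyDiffOp (Subalgebra.sub_mem _ (hT ψ List.mem_cons_self)
          (linForm_sub_mem_freeOf h)), ih hT' (by omega), map_zero, add_zero]
  refine ⟨hz, fun T hT hlen c hc h0 => ?_⟩
  match T with
  | [] => simp at hlen
  | ψ :: T =>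
    rw [List.length_cons] at hlen
    have hT' : ∀ ψ ∈ T, ψ - X i ∈ freeOf i := fun φ hφ => hT φ (List.mem_cons_of_mem _ hφ)
    refine hV.mem_of_restrict T hT' (by omega) c hc ?_
    rw [polyDiffOp_mul, List.prod_cons, key, map_add, map_add, restrictZero_polyDiffOp hc
      (polyDiffOp l _ (polyDiffOp l _ W)),
      restrictZero_polyDiffOp (Subalgebra.sub_mem _ (hT ψ List.mem_cons_self)
          (linForm_sub_mem_freeOf h)), hz T hT' (by omega), map_zero, map_zero, add_zero] at h0
    rw [polyDiffOp_mul, h0]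

theorem polyAnn_edgeIntegral {l : ℕ} {i : Fin l} {χ : Fin l → ℝ} (h : χ i = 1)
    {V : MvPolynomial (Fin l) ℝ} {S : Set (MvPolynomial (Fin l) ℝ)}
    (hS : ∀ d ∈ S, d ∈ freeOf i) {T : List (MvPolynomial (Fin l) ℝ)}
    (hT : ∀ ψ ∈ T, ψ - X i ∈ freeOf i)
    (hV : polyAnn V = Ideal.span S ⊔ Ideal.span {T.prod})
    (hW : VanishesToOrder i (edgeIntegral i χ V) T.length (Ideal.span S)) :
    polyAnn (edgeIntegral i χ V) = Ideal.span S ⊔ Ideal.span {linForm χ * T.prod} := by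
  obtain ⟨h1, h2⟩ := edgeIntegral_spec h V
  set W := edgeIntegral i χ V
  have hTV : polyDiffOp l T.prod V = 0 := by
    rw [← mem_polyAnn, hV]
    exact Ideal.mem_sup_right (Ideal.subset_span rfl)
  have hJ : Ideal.span S ≤ polyAnn W := by
    rw [Ideal.span_le]
    intro d hd
    refine eq_zero_of_linForm_of_restrictZero h ?_ ?_
    · rw [polyDiffOp_comm, h1, ← mem_polyAnn, hV]
      exact Ideal.mem_sup_left (Ideal.subset_span hd)
    · rw [restrictZero_polyDiffOp (hS d hd), h2, map_zero]
  refine le_antisymm (fun P hP => ?_) (sup_le hJ ?_)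
  · obtain ⟨c, hc, Q, rfl⟩ := exists_free_add_linForm_mul h P
    have hcJ : c ∈ Ideal.span S := by
      refine hW.mem_of_restrict T hT rfl c hc ?_
      -- `T.prod` kills `V`, hence also the term `Q V`; only `c T.prod W` survives.
      have h3 := congrArg (polyDiffOp l T.prod) (mem_polyAnn.1 hP)
      rw [polyDiffOp_add, mul_comm (linForm χ), polyDiffOp_mul Q, h1, map_add,
        polyDiffOp_comm _ Q, hTV, map_zero, add_zero, map_zero, ← polyDiffOp_mul] at h3
      rw [mul_comm, h3, map_zero]
    have hQ : Q ∈ polyAnn V := by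
      have h3 := mem_polyAnn.1 hP
      rwa [polyDiffOp_add, mem_polyAnn.1 (hJ hcJ), zero_add, mul_comm, polyDiffOp_mul, h1] at h3
    refine Ideal.add_mem _ (Ideal.mem_sup_left hcJ) ?_
    rw [hV, Submodule.mem_sup] at hQ
    obtain ⟨a, ha, b, hb, rfl⟩ := hQ
    obtain ⟨b, rfl⟩ := Ideal.mem_span_singleton.1 hb
    rw [mul_add]
    exact Ideal.add_mem _ (Ideal.mem_sup_left (Ideal.mul_mem_left _ _ ha))
      (Ideal.mem_sup_right (Ideal.mem_span_singleton.2 ⟨b, by ring⟩))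
  · rw [Ideal.span_le, Set.singleton_subset_iff]
    change polyDiffOp l _ W = 0
    rw [mul_comm, polyDiffOp_mul, h1, hTV]

/-! ### Iteration over a list of edges -/

/-- The polynomial obtained from `1` by integrating along the edges of a list. -/
def flowPoly {l : ℕ} {ι : Type*} (src : ι → Fin l) (χ : ι → Fin l → ℝ) :
    List ι → MvPolynomial (Fin l) ℝ
  | [] => 1
  | a :: L => edgeIntegral (src a) (χ a) (flowPoly src χ L)

/-- The factors of the operator of the vertex `i`. -/
def edgeForms {l : ℕ} {ι : Type*} (src : ι → Fin l) (χ : ι → Fin l → ℝ) (L : List ι)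
    (i : Fin l) : List (MvPolynomial (Fin l) ℝ) :=
  (L.filter (src · = i)).map (fun a => linForm (χ a)) ++ [X i]

theorem edgeForms_cons_self {l : ℕ} {ι : Type*} (src : ι → Fin l) (χ : ι → Fin l → ℝ)
    (L : List ι) (a : ι) :
    edgeForms src χ (a :: L) (src a) = linForm (χ a) :: edgeForms src χ L (src a) := by
  simp [edgeForms]

theorem edgeForms_cons_of_ne {l : ℕ} {ι : Type*} (src : ι → Fin l) (χ : ι → Fin l → ℝ)
    (L : List ι) {a : ι} {i : Fin l} (h : src a ≠ i) :
    edgeForms src χ (a :: L) i = edgeForms src χ L i := by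
  simp [edgeForms, h]

theorem edgeForms_of_lt {l : ℕ} {ι : Type*} (src : ι → Fin l) (χ : ι → Fin l → ℝ)
    {L : List ι} {i : Fin l} (h : ∀ a ∈ L, i < src a) :
    edgeForms src χ L i = [X i] := by
  have : L.filter (src · = i) = [] := by
    rw [List.filter_eq_nil_iff]
    intro a ha
    simpa using (h a ha).ne'
  simp [edgeForms, this]

theorem edgeForms_sub_mem_freeOf {l : ℕ} {ι : Type*} {src : ι → Fin l} {χ : ι → Fin l → ℝ}
    (h1 : ∀ a, χ a (src a) = 1) (L : List ι) (i : Fin l) :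
    ∀ ψ ∈ edgeForms src χ L i, ψ - X i ∈ freeOf i := by
  intro ψ hψ
  simp only [edgeForms, List.mem_append, List.mem_map, List.mem_filter, decide_eq_true_eq,
    List.mem_singleton] at hψ
  rcases hψ with ⟨a, ⟨_, rfl⟩, rfl⟩ | rfl
  · exact linForm_sub_mem_freeOf (h1 a)
  · simp

theorem edgeForms_prod_mem_freeOf {l : ℕ} {ι : Type*} {src : ι → Fin l} {χ : ι → Fin l → ℝ}
    (h0 : ∀ a k, k < src a → χ a k = 0) {L : List ι} {i k : Fin l} (hL : ∀ a ∈ L, i ≤ src a)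
    (hk : k ≠ i) :
    (edgeForms src χ L k).prod ∈ freeOf i := by
  refine Subalgebra.list_prod_mem _ fun ψ hψ => ?_
  simp only [edgeForms, List.mem_append, List.mem_map, List.mem_filter, decide_eq_true_eq,
    List.mem_singleton] at hψ
  rcases hψ with ⟨a, ⟨ha, rfl⟩, rfl⟩ | rfl
  · exact linForm_mem_freeOf (h0 a i (lt_of_le_of_ne (hL a ha) hk.symm))
  · exact Algebra.subset_adjoin ⟨k, hk, rfl⟩

theorem span_range_eq_sup {l : ℕ} (D : Fin l → MvPolynomial (Fin l) ℝ) (i : Fin l) :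
    Ideal.span (Set.range D) = Ideal.span (D '' {i}ᶜ) ⊔ Ideal.span {D i} := by
  rw [← Ideal.span_union, ← Set.image_singleton, ← Set.image_union, Set.compl_union_self,
    Set.image_univ]

theorem polyAnn_one (l : ℕ) :
    polyAnn (1 : MvPolynomial (Fin l) ℝ) = Ideal.span (Set.range X) := by
  have hle : Ideal.span (Set.range X) ≤ polyAnn (1 : MvPolynomial (Fin l) ℝ) := by
    rw [Ideal.span_le]
    rintro _ ⟨i, rfl⟩
    change polyDiffOp l _ _ = 0
    simp
  refine le_antisymm (fun P hP => ?_) hle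
  -- The variables kill `1`, so only the constant term of `P` acts on it.
  have hdec : P - C (constantCoeff P) ∈ Ideal.span (Set.range (X : Fin l → _)) := by
    rw [← Set.image_univ, mem_ideal_span_X_image]
    intro m hm
    by_contra! hcon
    have hm0 : m = 0 := Finsupp.ext fun i => by simpa using hcon i (Set.mem_univ i)
    rw [mem_support_iff, hm0] at hm
    simp [constantCoeff_eq] at hm
  have hc : C (constantCoeff P) ∈ polyAnn (1 : MvPolynomial (Fin l) ℝ) := by
    have := Ideal.sub_mem _ hP (hle hdec)
    simpa using this
  rw [mem_polyAnn, polyDiffOp_C] at hc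
  have hc0 : constantCoeff P = 0 := by simpa using hc
  simpa [hc0] using hdec

/-- The two claims need each other. Adding an edge at `i` uses the order of vanishing there, while
at a vertex `i` below all sources that order is `0` and is read off from the annihilator. The `- 1`
discounts the final factor `X i`, leaving the number of edges with source `i`. -/
theorem polyAnn_flowPoly_aux {l : ℕ} {ι : Type*} {src : ι → Fin l} {χ : ι → Fin l → ℝ}
    (h0 : ∀ a k, k < src a → χ a k = 0) (h1 : ∀ a, χ a (src a) = 1) {L : List ι}
    (hL : L.Pairwise (src · ≤ src ·)) :
    polyAnn (flowPoly src χ L) =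
      Ideal.span (Set.range fun i => (edgeForms src χ L i).prod) ∧
    ∀ i, (∀ a ∈ L, i ≤ src a) → VanishesToOrder i (flowPoly src χ L)
      ((edgeForms src χ L i).length - 1)
      (Ideal.span ((fun i => (edgeForms src χ L i).prod) '' {i}ᶜ)) := by
  have base : ∀ L : List ι, polyAnn (flowPoly src χ L) =
      Ideal.span (Set.range fun i => (edgeForms src χ L i).prod) → ∀ i, (∀ a ∈ L, i < src a) →
      VanishesToOrder i (flowPoly src χ L) ((edgeForms src χ L i).length - 1)
        (Ideal.span ((fun i => (edgeForms src χ L i).prod) '' {i}ᶜ)) := by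
    intro L hann i hi
    rw [edgeForms_of_lt src χ hi]
    refine vanishesToOrder_zero ?_ ?_
    · rintro _ ⟨k, hk, rfl⟩
      exact edgeForms_prod_mem_freeOf h0 (fun a ha => (hi a ha).le) hk
    · rw [hann, span_range_eq_sup _ i, edgeForms_of_lt src χ hi]
      simp
  induction L with
  | nil =>
    have hann : polyAnn (flowPoly src χ []) =
        Ideal.span (Set.range fun i => (edgeForms src χ [] i).prod) := by
      simpa [flowPoly, edgeForms] using polyAnn_one l
    exact ⟨hann, fun i _ => base [] hann i (by simp)⟩
  | cons a L ih =>
    obtain ⟨hle, hL⟩ := List.pairwise_cons.1 hL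
    obtain ⟨hann, hvan⟩ := ih hL
    have hfree : ∀ d ∈ (fun i => (edgeForms src χ L i).prod) '' {src a}ᶜ,
        d ∈ freeOf (src a) := by
      rintro _ ⟨k, hk, rfl⟩
      exact edgeForms_prod_mem_freeOf h0 hle hk
    have himg : (fun i => (edgeForms src χ (a :: L) i).prod) '' {src a}ᶜ =
        (fun i => (edgeForms src χ L i).prod) '' {src a}ᶜ := by
      refine Set.image_congr fun k hk => ?_
      rw [edgeForms_cons_of_ne _ _ _ (Ne.symm hk)]
    have hlen : (edgeForms src χ L (src a)).length - 1 + 1 = (edgeForms src χ L (src a)).length := by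
      simp [edgeForms]
    have hV := (hvan (src a) hle).edgeIntegral (h1 a)
    rw [hlen] at hV
    have hann' : polyAnn (flowPoly src χ (a :: L)) =
        Ideal.span (Set.range fun i => (edgeForms src χ (a :: L) i).prod) := by
      rw [span_range_eq_sup _ (src a)] at hann ⊢
      rw [himg, edgeForms_cons_self, List.prod_cons]
      exact polyAnn_edgeIntegral (h1 a) hfree (edgeForms_sub_mem_freeOf h1 L _) hann hV
    refine ⟨hann', fun i hi => ?_⟩
    rcases (hi a List.mem_cons_self).eq_or_lt with rfl | hlt
    · rw [himg, edgeForms_cons_self]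
      exact hV
    · refine base _ hann' i fun b hb => ?_
      rcases List.mem_cons.1 hb with rfl | hb
      · exact hlt
      · exact hlt.trans_le (hle b hb)

theorem polyAnn_flowPoly {l : ℕ} {ι : Type*} {src : ι → Fin l} {χ : ι → Fin l → ℝ}
    (h0 : ∀ a k, k < src a → χ a k = 0) (h1 : ∀ a, χ a (src a) = 1) {L : List ι}
    (hL : L.Pairwise (src · ≤ src ·)) :
    polyAnn (flowPoly src χ L) =
      Ideal.span (Set.range fun i => (edgeForms src χ L i).prod) :=
  (polyAnn_flowPoly_aux h0 h1 hL).1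

/-! ### Volumes by integration over one edge at a time -/

/-- The polytope of the `y ≥ 0` with `∑ y_a χ_a ≤ q`. -/
def edgePolytope {l : ℕ} {ι : Type*} [Fintype ι] (χ : ι → Fin l → ℝ) (q : Fin l → ℝ) :
    Set (ι → ℝ) :=
  {y | (∀ a, 0 ≤ y a) ∧ ∀ k, ∑ a, y a * χ a k ≤ q k}

theorem isClosed_edgePolytope {l : ℕ} {ι : Type*} [Fintype ι] (χ : ι → Fin l → ℝ)
    (q : Fin l → ℝ) : IsClosed (edgePolytope χ q) := by
  refine IsClosed.inter (s₁ := {y : ι → ℝ | ∀ a, 0 ≤ y a})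
    (s₂ := {y : ι → ℝ | ∀ k, ∑ a, y a * χ a k ≤ q k}) ?_ ?_
  · rw [Set.ofPred_forall]
    exact isClosed_iInter fun a => isClosed_le (by fun_prop) (by fun_prop)
  · rw [Set.ofPred_forall]
    exact isClosed_iInter fun a => isClosed_le (by fun_prop) (by fun_prop)

theorem edgePolytope_eq_empty {l : ℕ} {ι : Type*} [Fintype ι] {χ : ι → Fin l → ℝ}
    (hχ : ∀ a k, 0 ≤ χ a k) {q : Fin l → ℝ} {k : Fin l} (hq : q k < 0) :
    edgePolytope χ q = ∅ := by
  refine Set.eq_empty_of_forall_notMem fun y hy => ?_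
  have := Finset.sum_nonneg (s := Finset.univ) fun a _ => mul_nonneg (hy.1 a) (hχ a k)
  linarith [hy.2 k]

theorem volume_pi_succ_eq_lintegral {n : ℕ} {S : Set (Fin (n + 1) → ℝ)} (hS : MeasurableSet S) :
    MeasureTheory.volume S =
      ∫⁻ t : ℝ, MeasureTheory.volume {y : Fin n → ℝ | (Fin.cons t y : Fin (n + 1) → ℝ) ∈ S} := by
  have h := (MeasureTheory.volume_preserving_piFinSuccAbove (fun _ : Fin (n + 1) => ℝ) 0).symm
  rw [← h.measure_preimage hS.nullMeasurableSet, MeasureTheory.Measure.volume_eq_prod,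
    MeasureTheory.Measure.prod_apply (h.measurable hS)]
  refine MeasureTheory.lintegral_congr fun t => congrArg _ ?_
  ext y
  simp only [MeasurableEquiv.piFinSuccAbove, Set.mem_preimage, Set.mem_ofPred_eq]
  simp [Fin.consEquiv]

theorem volume_edgePolytope_succ {l n : ℕ} (χ : Fin (n + 1) → Fin l → ℝ) (q : Fin l → ℝ) :
    MeasureTheory.volume (edgePolytope χ q) =
      ∫⁻ t in Set.Ici (0 : ℝ),
        MeasureTheory.volume (edgePolytope (fun a : Fin n => χ a.succ) (q - t • χ 0)) := by
  rw [volume_pi_succ_eq_lintegral (isClosed_edgePolytope χ q).measurableSet,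
    ← MeasureTheory.lintegral_indicator measurableSet_Ici]
  refine MeasureTheory.lintegral_congr fun t => ?_
  by_cases ht : 0 ≤ t
  · rw [Set.indicator_of_mem (Set.mem_Ici.2 ht)]
    congr 1
    ext y
    simp only [edgePolytope, Set.mem_ofPred_eq, Fin.forall_fin_succ, Fin.cons_zero, Fin.cons_succ,
      Fin.sum_univ_succ, Pi.sub_apply, Pi.smul_apply, smul_eq_mul, ht, true_and, le_sub_iff_add_le']
  · rw [Set.indicator_of_notMem (by simpa using ht)]
    convert MeasureTheory.measure_empty (μ := MeasureTheory.volume)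
    refine Set.eq_empty_of_forall_notMem fun y hy => ht ?_
    simpa using hy.1 0

/-- The region `q ≥ 0`, `q_i ≤ q_{i+1} ≤ ⋯`. -/
def monotoneFrom {l : ℕ} (i : Fin l) : Set (Fin l → ℝ) :=
  {q | (∀ k, 0 ≤ q k) ∧ MonotoneOn q (Set.Ici i)}

/-- For `k ≥ i`, `q k - t * χ k ≥ q i - t ≥ 0` because `χ k ≤ χ i = 1`; monotonicity persists
because `-t • χ` increases from `i` on. -/
theorem sub_smul_mem_monotoneFrom {l : ℕ} {i : Fin l} {χ q : Fin l → ℝ} {t : ℝ}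
    (h0 : ∀ k < i, χ k = 0) (h1 : χ i = 1) (hanti : AntitoneOn χ (Set.Ici i))
    (hq : q ∈ monotoneFrom i) (ht : 0 ≤ t) (hti : t ≤ q i) :
    q - t • χ ∈ monotoneFrom i := by
  refine ⟨fun k => ?_, fun j hj k hk hjk => ?_⟩
  · simp only [Pi.sub_apply, Pi.smul_apply, smul_eq_mul]
    rcases lt_or_ge k i with hk | hk
    · rw [h0 k hk]; simpa using hq.1 k
    · have h2 := hq.2 (Set.self_mem_Ici) hk hk
      have h3 := hanti (Set.self_mem_Ici) hk hk
      rw [h1] at h3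
      nlinarith
  · simp only [Pi.sub_apply, Pi.smul_apply, smul_eq_mul]
    have h2 := hq.2 hj hk hjk
    have h3 := hanti hj hk hjk
    nlinarith

theorem volume_edgePolytope_list {l : ℕ} {ι : Type*} {src : ι → Fin l} {χ : ι → Fin l → ℝ}
    (h0 : ∀ a k, k < src a → χ a k = 0) (h1 : ∀ a, χ a (src a) = 1)
    (hanti : ∀ a, AntitoneOn (χ a) (Set.Ici (src a))) (hnn : ∀ a k, 0 ≤ χ a k) {L : List ι}
    (hL : L.Pairwise (src · ≤ src ·)) {i : Fin l} (hi : ∀ a ∈ L, i ≤ src a) {q : Fin l → ℝ}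
    (hq : q ∈ monotoneFrom i) :
    MeasureTheory.volume (edgePolytope (fun n => χ (L.get n)) q) =
      ENNReal.ofReal (eval q (flowPoly src χ L)) ∧ 0 ≤ eval q (flowPoly src χ L) := by
  induction L generalizing i q with
  | nil =>
    have : edgePolytope (fun n : Fin ([] : List ι).length => χ (([] : List ι).get n)) q =
        Set.univ := by
      refine Set.eq_univ_of_forall fun y => ⟨fun a => a.elim0, fun k => ?_⟩
      simpa using hq.1 k
    rw [this]
    simp [flowPoly, MeasureTheory.volume_pi]
  | cons a L ih =>
    obtain ⟨hle, hL⟩ := List.pairwise_cons.1 hL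
    have hq' : q ∈ monotoneFrom (src a) :=
      ⟨hq.1, hq.2.mono (Set.Ici_subset_Ici.2 (hi a List.mem_cons_self))⟩
    obtain ⟨hs1, hs2⟩ := edgeIntegral_spec (h1 a) (flowPoly src χ L)
    have hint : eval q (flowPoly src χ (a :: L)) =
        ∫ y in (0 : ℝ)..q (src a), eval (q - y • χ a) (flowPoly src χ L) :=
      eval_eq_integral (h1 a) hs1 hs2 q
    have hslice : ∀ t ∈ Set.Icc 0 (q (src a)), _ := fun t ht =>
      ih hL hle (sub_smul_mem_monotoneFrom (h0 a) (h1 a) (hanti a) hq' ht.1 ht.2)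
    have hcont : Continuous fun y : ℝ => eval (q - y • χ a) (flowPoly src χ L) :=
      (MvPolynomial.continuous_eval _).comp (by fun_prop)
    refine ⟨?_, ?_⟩
    · rw [hint, intervalIntegral.integral_of_le (hq.1 _), ← MeasureTheory.integral_Icc_eq_integral_Ioc,
        MeasureTheory.ofReal_integral_eq_lintegral_ofReal
          (hcont.integrableOn_Icc)
          ((MeasureTheory.ae_restrict_iff' measurableSet_Icc).2
            (Filter.Eventually.of_forall fun t ht => (hslice t ht).2))]
      refine (volume_edgePolytope_succ (fun n => χ ((a :: L).get n)) q).trans ?_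
      rw [← MeasureTheory.lintegral_indicator measurableSet_Ici,
        ← MeasureTheory.lintegral_indicator measurableSet_Icc]
      refine MeasureTheory.lintegral_congr fun t => ?_
      by_cases ht : t ∈ Set.Icc 0 (q (src a))
      · rw [Set.indicator_of_mem ht, Set.indicator_of_mem (Set.mem_Ici.2 ht.1)]
        exact (hslice t ht).1
      · rw [Set.indicator_of_notMem ht]
        by_cases ht0 : t ∈ Set.Ici 0
        · rw [Set.indicator_of_mem ht0]
          have hlt : q (src a) < t := by
            by_contra! hcon
            exact ht ⟨ht0, hcon⟩
          -- Beyond `t = q (src a)` the slice is empty, which is what bounds the integral.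
          rw [edgePolytope_eq_empty (fun _ _ => hnn _ _) (k := src a), MeasureTheory.measure_empty]
          simp [h1, hlt]
        · rw [Set.indicator_of_notMem ht0]
    · rw [hint]
      exact intervalIntegral.integral_nonneg (hq.1 _) fun t ht => (hslice t ht).2

theorem volume_edgePolytope_comp_equiv {l : ℕ} {ι κ : Type*} [Fintype ι] [Fintype κ] (e : ι ≃ κ)
    (χ : κ → Fin l → ℝ) (q : Fin l → ℝ) :
    MeasureTheory.volume (edgePolytope (fun a => χ (e a)) q) =
      MeasureTheory.volume (edgePolytope χ q) := by
  have h := MeasureTheory.volume_measurePreserving_piCongrLeft (fun _ : κ => ℝ) e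
  rw [← h.measure_preimage (isClosed_edgePolytope χ q).measurableSet.nullMeasurableSet]
  congr 1
  ext y
  have hy : ∀ a, (MeasurableEquiv.piCongrLeft (fun _ : κ => ℝ) e) y (e a) = y a :=
    fun a => Equiv.piCongrLeft_apply_apply (fun _ : κ => ℝ) e y a
  have hall : (∀ a, 0 ≤ (MeasurableEquiv.piCongrLeft (fun _ : κ => ℝ) e) y a) ↔ ∀ a, 0 ≤ y a := by
    rw [← e.forall_congr_right]
    simp only [hy]
  simp only [edgePolytope, Set.mem_preimage, Set.mem_ofPred_eq, hall,
    ← e.sum_comp (fun a => (MeasurableEquiv.piCongrLeft (fun _ : κ => ℝ) e) y a * _), hy]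

/-- For a finite family of edges, the volume of `edgePolytope` is given on the nice chamber by a
polynomial with the expected annihilator. -/
theorem exists_volume_polynomial {l : ℕ} (hl : 1 ≤ l) {ι : Type*} [Fintype ι] {src : ι → Fin l}
    {χ : ι → Fin l → ℝ} (h0 : ∀ a k, k < src a → χ a k = 0) (h1 : ∀ a, χ a (src a) = 1)
    (hanti : ∀ a, AntitoneOn (χ a) (Set.Ici (src a))) (hnn : ∀ a k, 0 ≤ χ a k) :
    ∃ V : MvPolynomial (Fin l) ℝ,
      (∀ q ∈ niceChamber l, MeasureTheory.volume.real (edgePolytope χ q) = eval q V) ∧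
      polyAnn V = Ideal.span (Set.range fun i =>
        X i * ∏ a with src a = i, linForm (χ a)) := by
  classical
  set L := (Finset.univ : Finset ι).toList.insertionSort (src · ≤ src ·)
  have hperm : L.Perm (Finset.univ : Finset ι).toList := List.perm_insertionSort _ _
  have hnodup : L.Nodup := hperm.nodup_iff.2 (Finset.nodup_toList _)
  have hmem : ∀ a, a ∈ L := fun a => hperm.mem_iff.2 (by simp)
  have : Std.Total (fun a b : ι => src a ≤ src b) := ⟨fun a b => le_total _ _⟩
  have : IsTrans ι (fun a b : ι => src a ≤ src b) := ⟨fun a b c => le_trans⟩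
  have hsort : L.Pairwise (src · ≤ src ·) := List.pairwise_insertionSort _ _
  refine ⟨flowPoly src χ L, fun q hq => ?_, ?_⟩
  · have hreg : q ∈ monotoneFrom (⟨0, hl⟩ : Fin l) :=
      ⟨fun k => (hq.1 k).le, hq.2.monotone.monotoneOn _⟩
    obtain ⟨hv, hpos⟩ := volume_edgePolytope_list h0 h1 hanti hnn hsort
      (fun a _ => Nat.zero_le _) hreg
    have he := volume_edgePolytope_comp_equiv (hnodup.getEquivOfForallMemList L hmem) χ q
    rw [MeasureTheory.measureReal_def, ← he]
    refine (congrArg ENNReal.toReal hv).trans (ENNReal.toReal_ofReal hpos)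
  · rw [polyAnn_flowPoly h0 h1 hsort]
    congr 2
    funext i
    rw [edgeForms, List.prod_append, List.prod_singleton, mul_comm]
    congr 1
    rw [((hperm.filter _).map _).prod_eq, ← Finset.prod_map_toList]
    refine List.Perm.prod_eq (List.Perm.map _ ?_)
    refine (List.perm_ext_iff_of_nodup ((Finset.nodup_toList _).filter _)
      (Finset.nodup_toList _)).2 fun a => ?_
    simp

/-! ### Polynomial and analytic partial derivatives -/

theorem isOpen_niceChamber (l : ℕ) : IsOpen (niceChamber l) := by
  have : niceChamber l = (⋂ i, {q : Fin l → ℝ | 0 < q i}) ∩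
      ⋂ i, ⋂ j, ⋂ _ : i < j, {q : Fin l → ℝ | q i < q j} := by
    ext q
    simp [niceChamber, StrictMono]
  rw [this]
  refine (isOpen_iInter_of_finite fun i => isOpen_lt (by fun_prop) (by fun_prop)).inter ?_
  exact isOpen_iInter_of_finite fun i => isOpen_iInter_of_finite fun j =>
    isOpen_iInter_of_finite fun _ => isOpen_lt (by fun_prop) (by fun_prop)

theorem partialDeriv_eqOn {l : ℕ} {U : Set (Fin l → ℝ)} (hU : IsOpen U) {f : (Fin l → ℝ) → ℝ}
    {V : MvPolynomial (Fin l) ℝ} (h : Set.EqOn f (fun q => eval q V) U) (i : Fin l) :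
    Set.EqOn (partialDeriv i f) (fun q => eval q (pderiv i V)) U := by
  intro q hq
  have h1 := hasDerivAt_eval_line V q (Pi.single i 1) 0
  rw [linForm_single, polyDiffOp_X, zero_smul, add_zero] at h1
  have h2 : HasLineDerivAt ℝ (fun q => eval q V) (eval q (pderiv i V)) q (Pi.single i 1) := h1
  have h3 : f =ᶠ[nhds q] fun q => eval q V := h.eventuallyEq_of_mem (hU.mem_nhds hq)
  exact (h2.congr_of_eventuallyEq h3).lineDeriv

theorem multiDeriv_eqOn {l : ℕ} {U : Set (Fin l → ℝ)} (hU : IsOpen U) {f : (Fin l → ℝ) → ℝ}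
    {V : MvPolynomial (Fin l) ℝ} (h : Set.EqOn f (fun q => eval q V) U) (s : Fin l →₀ ℕ) :
    Set.EqOn (multiDeriv s f) (fun q => eval q (polyDiffOp l (monomial s 1) V)) U := by
  have hiter : ∀ (i : Fin l) (n : ℕ) {g : (Fin l → ℝ) → ℝ} {W : MvPolynomial (Fin l) ℝ},
      Set.EqOn g (fun q => eval q W) U →
      Set.EqOn ((partialDeriv i)^[n] g) (fun q => eval q (polyDiffOp l (X i ^ n) W)) U := by
    intro i n
    induction n with
    | zero => intro g W hg; simpa using hg
    | succ n ih =>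
      intro g W hg
      rw [Function.iterate_succ_apply', pow_succ']
      simpa [polyDiffOp_mul] using partialDeriv_eqOn hU (ih hg) i
  have hfold : ∀ T : List (Fin l), Set.EqOn
      (T.foldr (fun i g => (partialDeriv i)^[s i] g) f)
      (fun q => eval q (polyDiffOp l (T.map fun i => X i ^ s i).prod V)) U := by
    intro T
    induction T with
    | nil => simpa using h
    | cons i T ih =>
      rw [List.foldr_cons, List.map_cons, List.prod_cons]
      simpa only [polyDiffOp_mul] using hiter i (s i) ih
  have hprod : (monomial s 1 : MvPolynomial (Fin l) ℝ) =
      ((List.finRange l).map fun i => X i ^ s i).prod := by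
    rw [monomial_eq, C_1, one_mul, Finsupp.prod_fintype _ _ (by simp), ← List.ofFn_eq_map,
      List.prod_ofFn]
  rw [hprod]
  exact hfold _

theorem diffOp_eqOn {l : ℕ} {U : Set (Fin l → ℝ)} (hU : IsOpen U) {f : (Fin l → ℝ) → ℝ}
    {V : MvPolynomial (Fin l) ℝ} (h : Set.EqOn f (fun q => eval q V) U)
    (P : MvPolynomial (Fin l) ℝ) :
    Set.EqOn (diffOp P f) (fun q => eval q (polyDiffOp l P V)) U := by
  intro q hq
  have hP : polyDiffOp l P V =
      ∑ s ∈ P.support, P.coeff s • polyDiffOp l (monomial s 1) V := by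
    conv_lhs => rw [P.as_sum, map_sum, LinearMap.sum_apply]
    refine Finset.sum_congr rfl fun s _ => ?_
    rw [← polyDiffOp_C, ← polyDiffOp_mul, C_mul_monomial, mul_one]
  simp only [diffOp, hP, map_sum, smul_eval]
  exact Finset.sum_congr rfl fun s _ => by rw [multiDeriv_eqOn hU h s hq]

theorem eq_zero_of_eval_niceChamber {l : ℕ} {W : MvPolynomial (Fin l) ℝ}
    (h : ∀ q ∈ niceChamber l, eval q W = 0) : W = 0 := by
  -- The chamber contains the box `∏ (k + 1, k + 2)`, a product of infinite sets.
  refine funext_set (fun k : Fin l => Set.Ioo ((k : ℝ) + 1) ((k : ℝ) + 2))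
    (fun k => Set.Ioo_infinite (by linarith)) fun q hq => ?_
  rw [map_zero]
  have hq' : ∀ k : Fin l, (k : ℝ) + 1 < q k ∧ q k < (k : ℝ) + 2 := fun k => hq k (Set.mem_univ k)
  refine h q ⟨fun k => ?_, fun j k hjk => ?_⟩
  · have := (hq' k).1
    have h0 : (0 : ℝ) ≤ (k : ℕ) := Nat.cast_nonneg _
    linarith
  · have h1 : ((j : ℕ) : ℝ) + 1 ≤ ((k : ℕ) : ℝ) := by exact_mod_cast hjk
    linarith [(hq' j).2, (hq' k).1]

theorem annihilator_eq_polyAnn {l : ℕ} {f : (Fin l → ℝ) → ℝ} {V : MvPolynomial (Fin l) ℝ}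
    (h : ∀ q ∈ niceChamber l, f q = eval q V) :
    annihilator (niceChamber l) f = (polyAnn V : Set (MvPolynomial (Fin l) ℝ)) := by
  ext P
  have hP := diffOp_eqOn (isOpen_niceChamber l) (f := f) (V := V) h P
  refine ⟨fun hPf => eq_zero_of_eval_niceChamber fun q hq => ?_, fun hPV q hq => ?_⟩
  · exact (hP hq).symm.trans (hPf q hq)
  · have : polyDiffOp l P V = 0 := hPV
    rw [hP hq]
    simp [this]

/-! ### The flow polytope in free coordinates -/

/-- The source of an edge. -/
def edgeSource {l : ℕ} (p : PosPair l) : Fin l :=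
  ⟨p.1.1, lt_of_lt_of_le p.2 (Nat.lt_succ_iff.1 p.1.2.2)⟩

/-- The coefficients of a positive root with respect to the simple roots. -/
def rootCoeff {l : ℕ} (p : PosPair l) (k : Fin l) : ℝ :=
  if (p.1.1 : ℕ) ≤ k ∧ (k : ℕ) < p.1.2 then 1 else 0

theorem eq_of_sum_Iic_eq {n : ℕ} {f g : Fin n → ℝ}
    (h : ∀ v, ∑ w ∈ Finset.Iic v, f w = ∑ w ∈ Finset.Iic v, g w) : f = g := by
  funext v
  induction v using WellFoundedLT.induction with
  | _ v ih =>
    have hv := h v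
    rw [← Finset.Iio_insert, Finset.sum_insert (by simp), Finset.sum_insert (by simp),
      Finset.sum_congr rfl fun w hw => ih w (Finset.mem_Iio.1 hw)] at hv
    exact add_right_cancel hv

theorem sum_Iic_posRoot {l : ℕ} (p : PosPair l) (v : Fin (l + 1)) :
    ∑ w ∈ Finset.Iic v, posRoot p w =
      (if p.1.1 ≤ v then 1 else 0) - (if p.1.2 ≤ v then 1 else 0) := by
  simp [posRoot, Finset.sum_sub_distrib, Finset.sum_pi_single']

theorem sum_Iic_simpleRoot {l : ℕ} (i : Fin l) (v : Fin (l + 1)) :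
    ∑ w ∈ Finset.Iic v, simpleRoot i w = if (i : ℕ) = v then 1 else 0 := by
  simp only [simpleRoot, Pi.sub_apply, Finset.sum_sub_distrib, Finset.sum_pi_single',
    Finset.mem_Iic, Fin.le_def, Fin.val_castSucc, Fin.val_succ]
  split_ifs <;> first | omega | norm_num

/-- Partial sums over initial vertices turn simple roots into unit vectors, and so read off
coefficients in the simple roots. -/
theorem sum_smul_posRoot_eq_iff {l : ℕ} {ι : Type*} [Fintype ι] (p : ι → PosPair l) (x : ι → ℝ)
    (q : Fin l → ℝ) :
    ∑ a, x a • posRoot (p a) = rootComb q ↔ ∀ k, ∑ a, x a * rootCoeff (p a) k = q k := by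
  have hL : ∀ v : Fin (l + 1), ∑ w ∈ Finset.Iic v, (∑ a, x a • posRoot (p a)) w =
      ∑ a, x a * ((if (p a).1.1 ≤ v then 1 else 0) - (if (p a).1.2 ≤ v then 1 else 0)) := by
    intro v
    simp only [Finset.sum_apply, Pi.smul_apply, smul_eq_mul]
    rw [Finset.sum_comm]
    simp only [← Finset.mul_sum, sum_Iic_posRoot]
  have hR : ∀ v : Fin (l + 1), ∑ w ∈ Finset.Iic v, rootComb q w =
      ∑ i : Fin l, q i * if (i : ℕ) = v then 1 else 0 := by
    intro v
    simp only [rootComb, Finset.sum_apply, Pi.smul_apply, smul_eq_mul]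
    rw [Finset.sum_comm]
    simp only [← Finset.mul_sum, sum_Iic_simpleRoot]
  have hLk : ∀ k : Fin l, ∑ w ∈ Finset.Iic k.castSucc, (∑ a, x a • posRoot (p a)) w =
      ∑ a, x a * rootCoeff (p a) k := by
    intro k
    rw [hL]
    refine Finset.sum_congr rfl fun a _ => ?_
    have := (p a).2
    simp only [rootCoeff, Fin.le_def, Fin.lt_def, Fin.val_castSucc] at this ⊢
    congr 1
    split_ifs <;> first | omega | norm_num
  have hRk : ∀ k : Fin l, ∑ w ∈ Finset.Iic k.castSucc, rootComb q w = q k := by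
    intro k
    rw [hR]
    simp [Fin.val_inj]
  constructor
  · intro h k
    rw [← hLk, h, hRk]
  · intro h
    refine eq_of_sum_Iic_eq fun v => ?_
    refine Fin.lastCases ?_ (fun k => ?_) v
    -- Over all vertices every root sums to zero, so the last equation is automatic.
    · rw [hL, hR]
      simp [Fin.le_last, (Fin.is_lt _).ne]
    · rw [hLk, hRk, h k]

/-- The edge `x_{i,i+1}^1`. -/
def simpleEdge {l : ℕ} {m : Fin (l + 1) → Fin (l + 1) → ℕ} (hm : ∀ i j, i < j → 0 < m i j)
    (i : Fin l) : FlowIndex l m :=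
  ⟨⟨(i.castSucc, i.succ), Fin.castSucc_lt_succ⟩, ⟨0, hm _ _ Fin.castSucc_lt_succ⟩⟩

theorem exists_simpleEdge_eq {l : ℕ} {m : Fin (l + 1) → Fin (l + 1) → ℕ}
    (hm : ∀ i j, i < j → 0 < m i j) {a : FlowIndex l m}
    (ha : (a.1.1.1 : ℕ) + 1 = (a.1.1.2 : ℕ) ∧ (a.2 : ℕ) = 0) :
    simpleEdge hm (edgeSource a.1) = a := by
  have key : ∀ (i₀ : Fin l) (i j : Fin (l + 1)) (hij : i < j) (k : Fin (m i j)),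
      i = i₀.castSucc → j = i₀.succ → (k : ℕ) = 0 →
      simpleEdge hm i₀ = (⟨⟨(i, j), hij⟩, k⟩ : FlowIndex l m) := by
    rintro i₀ i j hij k rfl rfl hk
    obtain rfl : k = ⟨0, hm _ _ hij⟩ := Fin.ext hk
    rfl
  exact key _ _ _ a.1.2 a.2 rfl (Fin.ext ha.1.symm) ha.2

/-- All edges are the free ones and the `x_{i,i+1}^1`. -/
def edgeSplit {l : ℕ} {m : Fin (l + 1) → Fin (l + 1) → ℕ} (hm : ∀ i j, i < j → 0 < m i j) :
    FreeIndex l m ⊕ Fin l ≃ FlowIndex l m where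
  toFun := Sum.elim (fun a => a.1) (simpleEdge hm)
  invFun a := if ha : (a.1.1.1 : ℕ) + 1 = (a.1.1.2 : ℕ) ∧ (a.2 : ℕ) = 0
    then Sum.inr (edgeSource a.1) else Sum.inl ⟨a, ha⟩
  left_inv := by
    rintro (⟨a, ha⟩ | i)
    · simp [ha]
    · simp [simpleEdge, edgeSource]
  right_inv a := by
    by_cases ha : (a.1.1.1 : ℕ) + 1 = (a.1.1.2 : ℕ) ∧ (a.2 : ℕ) = 0
    · simp only [ha, and_self, dite_true, Sum.elim_inr]
      exact exists_simpleEdge_eq hm ha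
    · simp [ha]

theorem rootCoeff_simpleEdge {l : ℕ} {m : Fin (l + 1) → Fin (l + 1) → ℕ}
    (hm : ∀ i j, i < j → 0 < m i j) (i k : Fin l) :
    rootCoeff (simpleEdge hm i).1 k = if i = k then 1 else 0 := by
  simp only [rootCoeff, simpleEdge, Fin.val_castSucc, Fin.val_succ, Fin.ext_iff]
  have h : (i : ℕ) ≤ k ∧ (k : ℕ) < i + 1 ↔ (i : ℕ) = k := by omega
  simp only [h]

theorem sum_flowIndex {l : ℕ} {m : Fin (l + 1) → Fin (l + 1) → ℕ}
    (hm : ∀ i j, i < j → 0 < m i j) (x : FlowIndex l m → ℝ) (k : Fin l) :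
    ∑ a, x a * rootCoeff a.1 k =
      ∑ a : FreeIndex l m, x a.1 * rootCoeff a.1.1 k + x (simpleEdge hm k) := by
  rw [← (edgeSplit hm).sum_comp, Fintype.sum_sum_type]
  simp [edgeSplit, rootCoeff_simpleEdge]

theorem image_flowPolytope {l : ℕ} {m : Fin (l + 1) → Fin (l + 1) → ℕ}
    (hm : ∀ i j, i < j → 0 < m i j) (q : Fin l → ℝ) :
    (fun (x : FlowIndex l m → ℝ) (a : FreeIndex l m) => x a.1) '' flowPolytope l m (rootComb q) =
      edgePolytope (fun a : FreeIndex l m => rootCoeff a.1.1) q := by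
  ext y
  constructor
  · rintro ⟨x, ⟨hx, hsum⟩, rfl⟩
    rw [sum_smul_posRoot_eq_iff (fun a : FlowIndex l m => a.1)] at hsum
    refine ⟨fun a => hx a.1, fun k => ?_⟩
    rw [← hsum k, sum_flowIndex hm]
    linarith [hx (simpleEdge hm k)]
  · rintro ⟨hy, hsum⟩
    -- The forgotten coordinates are recovered as the slacks of the inequalities.
    let x : FlowIndex l m → ℝ := fun a => Sum.elim y
      (fun k => q k - ∑ a : FreeIndex l m, y a * rootCoeff a.1.1 k) ((edgeSplit hm).symm a)
    have hx1 : ∀ a : FreeIndex l m, x a.1 = y a := fun a => by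
      change Sum.elim _ _ ((edgeSplit hm).symm (edgeSplit hm (Sum.inl a))) = _
      rw [Equiv.symm_apply_apply, Sum.elim_inl]
    have hx2 : ∀ k, x (simpleEdge hm k) =
        q k - ∑ a : FreeIndex l m, y a * rootCoeff a.1.1 k := fun k => by
      change Sum.elim _ _ ((edgeSplit hm).symm (edgeSplit hm (Sum.inr k))) = _
      rw [Equiv.symm_apply_apply, Sum.elim_inr]
    refine ⟨x, ⟨fun a => ?_, ?_⟩, funext hx1⟩
    · obtain ⟨b | k, rfl⟩ := (edgeSplit hm).surjective a
      · exact (hx1 b).symm ▸ hy b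
      · have := hx2 k
        change 0 ≤ x (simpleEdge hm k)
        linarith [hsum k]
    · rw [sum_smul_posRoot_eq_iff (fun a : FlowIndex l m => a.1)]
      intro k
      rw [sum_flowIndex hm, hx2]
      simp only [hx1]
      ring

theorem linForm_rootCoeff {l : ℕ} (p : PosPair l) :
    linForm (rootCoeff p) =
      ∑ k : Fin l with edgeSource p ≤ k ∧ k.castSucc < p.1.2, X k := by
  rw [linForm, Finset.sum_filter]
  refine Finset.sum_congr rfl fun k _ => ?_
  simp only [rootCoeff, edgeSource, Fin.le_def, Fin.lt_def, Fin.val_castSucc]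
  split_ifs <;> simp

theorem flowOperator_eq {l : ℕ} {m : Fin (l + 1) → Fin (l + 1) → ℕ}
    (hm : ∀ i j, i < j → 0 < m i j) (i : Fin l) :
    flowOperator l m i =
      X i * ∏ a : FreeIndex l m with edgeSource a.1.1 = i, linForm (rootCoeff a.1.1) := by
  have h1 : flowOperator l m i =
      ∏ a : FlowIndex l m, if edgeSource a.1 = i then linForm (rootCoeff a.1) else 1 := by
    rw [Fintype.prod_sigma]
    simp only [Finset.prod_const, Finset.card_univ, Fintype.card_fin]
    rw [flowOperator]
    -- Pairs with another source contribute the factor `1`, so only factors different from `1` are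
    -- matched.
    refine Finset.prod_bij_ne_one (fun j hj _ => ⟨(i.castSucc, j), Finset.mem_Ioi.1 hj⟩)
      ?_ ?_ ?_ ?_
    · simp
    · intro j _ _ k _ _ h
      simpa using h
    · rintro ⟨⟨a, j⟩, haj⟩ - hne
      by_cases ha : edgeSource ⟨(a, j), haj⟩ = i
      · subst ha
        rw [if_pos rfl, linForm_rootCoeff] at hne
        exact ⟨j, Finset.mem_Ioi.2 haj, hne, rfl⟩
      · simp [ha] at hne
    · intro j hj _
      have he : edgeSource ⟨(i.castSucc, j), Finset.mem_Ioi.1 hj⟩ = i := rfl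
      rw [if_pos he, linForm_rootCoeff, he]
  rw [h1, ← (edgeSplit hm).prod_comp, Fintype.prod_sum_type, mul_comm, Finset.prod_filter]
  congr 1
  rw [Finset.prod_eq_single i]
  · have hs : rootCoeff (simpleEdge hm i).1 = Pi.single i 1 := by
      funext k
      simp [rootCoeff_simpleEdge, Pi.single_apply, eq_comm]
    have he : edgeSource (simpleEdge hm i).1 = i := rfl
    simp [edgeSplit, he, hs, linForm_single]
  · intro k _ hk
    have he : edgeSource (simpleEdge hm k).1 = k := rfl
    simp [edgeSplit, he, hk]
  · simp

end

theorem theorem3p8 (l : ℕ) (hl : 1 ≤ l) (m : Fin (l + 1) → Fin (l + 1) → ℕ)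
    (hm : ∀ i j, i < j → 0 < m i j) :
    (∃ V : MvPolynomial (Fin l) ℝ, ∀ q ∈ niceChamber l,
      flowVolume l m q = MvPolynomial.eval q V) ∧
    annihilator (niceChamber l) (flowVolume l m) =
      (Ideal.span (Set.range (flowOperator l m)) : Set (MvPolynomial (Fin l) ℝ)) := by
  obtain ⟨V, hV, hann⟩ := exists_volume_polynomial hl
    (src := fun a : FreeIndex l m => edgeSource a.1.1) (χ := fun a => rootCoeff a.1.1)
    (fun a k hk => if_neg fun h => absurd h.1 (not_le.2 hk))
    (fun a => if_pos ⟨le_rfl, a.1.1.2⟩)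
    (fun a j hj k hk hjk => by
      simp only [Set.mem_Ici, edgeSource, Fin.le_def] at hj hk hjk
      simp only [rootCoeff]
      split_ifs <;> first | omega | norm_num)
    (fun a k => by
      simp only [rootCoeff]
      split_ifs <;> norm_num)
  have hvol : ∀ q ∈ niceChamber l, flowVolume l m q = eval q V := fun q hq => by
    rw [flowVolume, image_flowPolytope hm, hV q hq]
  refine ⟨⟨V, hvol⟩, ?_⟩
  rw [annihilator_eq_polyAnn hvol, hann]
  congr 3
  funext i
  exact (flowOperator_eq hm i).symm
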